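/- Let $\Lambda$ be the algebra of symmetric functions over $\mathbb{R}$ in the variables $\mathbf{x}=(x_1,x_2,\dots)$, let $h_n=h_n(\mathbf{x})$ be the complete homogeneous symmetric function of degree $n$, and let $H(z)=\sum_{n\ge 0}h_n z^n$. Define polynomials $Q_n=Q_n(\mathbf{x},t)\in\Lambda[t]$ by $$\sum_{n\ge 0}Q_n(\mathbf{x},t)\,z^n=\frac{(1-t)H(z)}{H(tz)-tH(z)},$$ and, for $n\ge 0$, $$\tilde Q_n(\mathbf{x},t)=h_n(\mathbf{x})+t\sum_{m=1}^n h_{n-m}(\mathbf{x})\,Q_m(\mathbf{x},t).$$ Call $f\in\Lambda$ Schur-positive if its expansion in the basis of Schur functions has nonnegative coefficients, and write $f\le_s g$ if $g-f$ is Schur-positive. A polynomial $A(t)=a_0+a_1t+\cdots+a_mt^m\in\Lambda[t]$ is called palindromic with center of symmetry $\frac m2$ if $a_j=a_{m-j}$ for $0\le j\le m$; Schur-positive if every $a_j$ is Schur-positive; and Schur-unimodal if $a_0\le_s a_1\le_s\cdots\le_s a_c\ge_s a_{c+1}\ge_s\cdots\ge_s a_m$ for some $c$. Then for all $n\ge 0$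 the polynomials $Q_n(\mathbf{x},t)$ and $\tilde Q_n(\mathbf{x},t)$ are palindromic, Schur-positive and Schur-unimodal. The center of symmetry of $Q_n$ is $\frac{n-1}2$ if $n\ge 1$ and $0$ if $n=0$ (where $Q_0=1$), and that of $\tilde Q_n$ is $\frac n2$. -/

import Mathlib

noncomputable section

namespace SymFn

/-- The `ℝ`-algebra `Λ` of symmetric functions in the variables `x₀, x₁, x₂, …`: the formal power
series of bounded degree that are invariant under every permutation of the variables. -/
def symmetricFunctions : Subalgebra ℝ (MvPowerSeries ℕ ℝ) where
  carrier := {f | (∀ e : Equiv.Perm ℕ, MvPowerSeries.renameEquiv ℝ e f = f) ∧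
    ∃ N : ℕ, ∀ d : ℕ →₀ ℕ, N < d.degree → MvPowerSeries.coeff d f = 0}
  mul_mem' := by
    rintro f g ⟨hf, N, hN⟩ ⟨hg, M, hM⟩
    refine ⟨fun e => by rw [map_mul, hf e, hg e], N + M, fun d hd => ?_⟩
    rw [MvPowerSeries.coeff_mul]
    refine Finset.sum_eq_zero fun p hp => ?_
    have h1 : p.1.degree + p.2.degree = d.degree := by
      rw [← map_add, Finset.HasAntidiagonal.mem_antidiagonal.mp hp]
    by_cases h2 : N < p.1.degree
    · rw [hN _ h2, zero_mul]
    · rw [hM _ (by omega), mul_zero]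
  add_mem' := by
    rintro f g ⟨hf, N, hN⟩ ⟨hg, M, hM⟩
    refine ⟨fun e => by rw [map_add, hf e, hg e], N + M, fun d hd => ?_⟩
    rw [map_add, hN _ (by omega), hM _ (by omega), add_zero]
  algebraMap_mem' := by
    intro r
    refine ⟨fun e => AlgEquiv.commutes _ r, 0, fun d hd => ?_⟩
    rw [MvPowerSeries.algebraMap_apply]
    have h : d ≠ 0 := by
      rintro rfl
      simp at hd
    simp [MvPowerSeries.coeff_C, h]

/-- The type of symmetric functions over `ℝ`, with its ring and algebra structures. -/
def Lam : Type := symmetricFunctions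

instance : CommRing Lam := inferInstanceAs (CommRing symmetricFunctions)

instance : Algebra ℝ Lam := inferInstanceAs (Algebra ℝ symmetricFunctions)

instance : NoZeroDivisors Lam := inferInstanceAs (NoZeroDivisors symmetricFunctions)

instance : Nontrivial Lam := inferInstanceAs (Nontrivial symmetricFunctions)

/-- The inclusion of the symmetric functions into the formal power series. -/
def toSeries : Lam →ₐ[ℝ] MvPowerSeries ℕ ℝ := symmetricFunctions.val

/-- The complete homogeneous symmetric function `h_n`, the sum of all monomials of degree `n`. -/
def h (n : ℕ) : Lam :=
  ⟨fun d => if d.degree = n then 1 else 0, by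
    refine ⟨fun e => ?_, n, fun d hd => ?_⟩
    · ext d
      have key : ∀ d : ℕ →₀ ℕ, MvPowerSeries.coeff d
          ((fun d => if d.degree = n then 1 else 0 : (ℕ →₀ ℕ) → ℝ) : MvPowerSeries ℕ ℝ) =
          if d.degree = n then 1 else 0 := fun d => rfl
      have hd : d = Finsupp.embDomain e.toEmbedding (Finsupp.mapDomain e.symm d) := by
        rw [Finsupp.embDomain_eq_mapDomain, ← Finsupp.mapDomain_comp]
        simp [Finsupp.mapDomain_id]
      have h2 := MvPowerSeries.coeff_embDomain_rename (R := ℝ) e.toEmbedding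
        ((fun d => if d.degree = n then 1 else 0 : (ℕ →₀ ℕ) → ℝ) : MvPowerSeries ℕ ℝ)
        (Finsupp.mapDomain e.symm d)
      rw [← hd, key, Finsupp.degree_mapDomain] at h2
      exact h2
    · change (if d.degree = n then (1 : ℝ) else 0) = 0
      rw [if_neg (by omega)]⟩

/-- The content of a semistandard Young tableau: the number of times that each entry occurs. -/
def content {μ : YoungDiagram} (T : SemistandardYoungTableau μ) : ℕ →₀ ℕ :=
  ∑ c ∈ μ.cells, Finsupp.single (T c.1 c.2) 1

/-- There are only finitely many semistandard tableaux of a given shape and content. -/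
theorem finite_tableaux (μ : YoungDiagram) (d : ℕ →₀ ℕ) :
    Finite {T : SemistandardYoungTableau μ // content T = d} := by
  have hmem : ∀ (T : {T : SemistandardYoungTableau μ // content T = d}) (c : μ.cells),
      T.1 c.1.1 c.1.2 ∈ d.support := by
    rintro ⟨T, rfl⟩ ⟨c, hc⟩
    simp only [Finsupp.mem_support_iff, content, Finsupp.finsetSum_apply]
    have := Finset.single_le_sum (f := fun c' : ℕ × ℕ =>
      (Finsupp.single (T c'.1 c'.2) 1 : ℕ →₀ ℕ) (T c.1 c.2)) (fun _ _ => Nat.zero_le _) hc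
    simp only [Finsupp.single_eq_same] at this
    omega
  refine Finite.of_injective (β := μ.cells → d.support)
    (fun T c => ⟨T.1 c.1.1 c.1.2, hmem T c⟩) fun T T' hT => ?_
  apply Subtype.ext
  ext i j
  by_cases hij : (i, j) ∈ μ
  · exact congrArg Subtype.val (congrFun hT ⟨(i, j), hij⟩)
  · rw [T.1.zeros hij, T'.1.zeros hij]

/-- The Schur function `s_μ`, the sum of `x^(content T)` over all semistandard Young tableaux `T`
of shape `μ`. (Integer partitions are identified with their Young diagrams.) -/
def schur (μ : YoungDiagram) : MvPowerSeries ℕ ℝ :=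
  fun d => (Nat.card {T : SemistandardYoungTableau μ // content T = d} : ℝ)

/-- `f` has an expansion into Schur functions with nonnegative coefficients. -/
def SchurPositive (f : Lam) : Prop :=
  ∃ c : YoungDiagram →₀ ℝ, (∀ μ, 0 ≤ c μ) ∧
    toSeries f = c.sum fun μ a => a • schur μ

/-- The relation `f ≤ g` of the Schur basis: `g - f` is Schur-positive. -/
def SchurLE (f g : Lam) : Prop := SchurPositive (g - f)

/-- `A = a_0 + a_1 t + ⋯ + a_m t^m` with `a_j = a_{m-j}` for `0 ≤ j ≤ m`, that is, `A` is
palindromic with center of symmetry `m / 2`. -/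
def PalindromicOfCenterHalf (m : ℕ) (A : Polynomial Lam) : Prop :=
  A.natDegree ≤ m ∧ ∀ j ≤ m, A.coeff j = A.coeff (m - j)

/-- Every coefficient of the polynomial `A` is Schur-positive. -/
def SchurPositivePoly (A : Polynomial Lam) : Prop :=
  ∀ j, SchurPositive (A.coeff j)

/-- `A = a_0 + a_1 t + ⋯ + a_m t^m` with `a_0 ≤ ⋯ ≤ a_c ≥ ⋯ ≥ a_m` for some `c`, in the order of
the Schur basis. -/
def SchurUnimodalPoly (m : ℕ) (A : Polynomial Lam) : Prop :=
  A.natDegree ≤ m ∧ ∃ c ≤ m,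
    (∀ j, j < c → SchurLE (A.coeff j) (A.coeff (j + 1))) ∧
    (∀ j, c ≤ j → j < m → SchurLE (A.coeff (j + 1)) (A.coeff j))

/-- The generating function `H(z) = ∑ h_n z^n`, with coefficients in `Λ[t]`. -/
def H : PowerSeries (Polynomial Lam) := PowerSeries.mk fun n => Polynomial.C (h n)

/-- `H(tz)`. -/
def Ht : PowerSeries (Polynomial Lam) := PowerSeries.rescale Polynomial.X H

/-- The indeterminate `t`, as an element of `Λ[t][[z]]`. -/
def t : PowerSeries (Polynomial Lam) := PowerSeries.C Polynomial.X

theorem h_zero : h 0 = 1 := by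
  apply Subtype.ext
  ext d
  change (if d.degree = 0 then (1 : ℝ) else 0) = MvPowerSeries.coeff d (1 : MvPowerSeries ℕ ℝ)
  rw [MvPowerSeries.coeff_one]
  simp [Finsupp.degree_eq_zero_iff]

/-- The quotient `(1 - t) H(z) / (H(tz) - t H(z))` exists and is unique in `Λ[t][[z]]`. -/
theorem existsUnique_quotient :
    ∃! Q : ℕ → Polynomial Lam, PowerSeries.mk Q * (Ht - t * H) = (1 - t) * H := by
  let E : ℕ → Polynomial Lam := fun n =>
    if n = 0 then 1 else -(Polynomial.X * ∑ i ∈ Finset.range (n - 1), Polynomial.X ^ i)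
  have hE : ∀ n, (1 - Polynomial.X) * E n = Polynomial.X ^ n - Polynomial.X := by
    intro n
    rcases n with _ | n
    · simp [E]
    · have := geom_sum_mul (Polynomial.X : Polynomial Lam) n
      simp only [E, Nat.add_one_ne_zero, if_false, Nat.add_sub_cancel]
      rw [pow_succ]
      linear_combination (Polynomial.X) * this
  let D : PowerSeries (Polynomial Lam) := PowerSeries.mk fun n => E n * Polynomial.C (h n)
  have hD : Ht - t * H = (1 - t) * D := by
    ext1 n
    have h1 : (1 - t) * D = D - t * D := by ring
    rw [h1]
    simp only [map_sub, Ht, t, H, D, PowerSeries.coeff_rescale, PowerSeries.coeff_C_mul,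
      PowerSeries.coeff_mk]
    linear_combination (-Polynomial.C (h n)) * hE n
  have hD0 : PowerSeries.constantCoeff D = ((1 : (Polynomial Lam)ˣ) : Polynomial Lam) := by
    rw [← PowerSeries.coeff_zero_eq_constantCoeff_apply]
    simp [D, E, h_zero]
  have hinv := PowerSeries.mul_invOfUnit D 1 hD0
  have hne : Ht - t * H ≠ 0 := by
    rw [hD]
    refine mul_ne_zero ?_ (fun h0 => ?_)
    · intro h0
      have h1 := congrArg (PowerSeries.coeff 0) h0
      simp only [map_sub, t, PowerSeries.coeff_zero_C, PowerSeries.coeff_zero_one, map_zero] at h1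
      have h2 := congrArg (fun p : Polynomial Lam => p.coeff 0) h1
      simp at h2
    · rw [h0] at hinv
      simp at hinv
  refine ⟨fun n => PowerSeries.coeff n (H * PowerSeries.invOfUnit D 1), ?_, ?_⟩
  · have h1 : PowerSeries.mk (fun n => PowerSeries.coeff n (H * PowerSeries.invOfUnit D 1)) =
        H * PowerSeries.invOfUnit D 1 := by
      ext1 n
      rw [PowerSeries.coeff_mk]
    dsimp only
    rw [h1, hD]
    linear_combination ((1 - t) * H) * hinv
  · intro Q hQ
    have h2 : PowerSeries.mk Q = H * PowerSeries.invOfUnit D 1 := by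
      refine mul_right_cancel₀ hne ?_
      rw [hQ, hD]
      linear_combination (-(1 - t) * H) * hinv
    funext n
    rw [← h2, PowerSeries.coeff_mk]

/-- The polynomials `Q_n ∈ Λ[t]`, defined by
`∑ Q_n z^n = (1 - t) H(z) / (H(tz) - t H(z))`. -/
def Q : ℕ → Polynomial Lam := existsUnique_quotient.choose

/-- The defining identity of the `Q_n`, with the denominator cleared. -/
theorem Q_spec : PowerSeries.mk Q * (Ht - t * H) = (1 - t) * H :=
  existsUnique_quotient.choose_spec.1

/-- The polynomials `Q̃_n = h_n + t ∑_{m=1}^n h_{n-m} Q_m`. -/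
def Qtilde (n : ℕ) : Polynomial Lam :=
  Polynomial.C (h n) + Polynomial.X * ∑ m ∈ Finset.Icc 1 n, Polynomial.C (h (n - m)) * Q m

end SymFn

end

noncomputable section

namespace SymFn

/-! Write `[k] = 1 + t + ⋯ + t^(k-1)`. Cancelling `1 - t` in the definition of `Q` leaves `(∑ Q_n
z^n) D = H(z)` with `D = 1 - ∑_{k≥2} t[k-1] h_k z^k`, and then `(∑ Q̃_n z^n) D = H(z) H(tz)`. Both
families therefore satisfy recurrences with only plus signs, in which each earlier polynomial is
multiplied by `t[k-1] h_k`.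

All three properties are carried by one cone, `symmetricUnimodal m`: sums of `c t^i [m+1-2i]` with
`c` Schur-positive. Multiplication by `t[k-1] h_k` moves the center by `k/2` and preserves these
cones, since `[a][b]` is a sum of centered geometric sums (`bracket_mul_bracket`) and multiplication
by `h_k` preserves Schur-positivity. The starting terms lie in the cone too: `h_n [n]` for `Q_n`,
and `∑ h_j h_{n-j} t^j` for `Q̃_n`. The latter is unimodal because `h_{a+1} h_b - h_a h_{b+1}` is
Schur-positive for `a ≤ b` (`schurLE_h_mul_h`).

The facts needed about Schur functions all come from the Pieri formula `h_mul_schur`, proved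
bijectively by induction on the number of letters. The linear independence of Schur functions plays
no role. -/

/-! ### Horizontal strips and diagrams given by row lengths. -/

/-- `μ / ν` is a horizontal strip: the row lengths of `μ` and `ν` interlace. -/
def HorizontalStrip (μ ν : YoungDiagram) : Prop :=
  ∀ i, ν.rowLen i ≤ μ.rowLen i ∧ μ.rowLen (i + 1) ≤ ν.rowLen i

theorem HorizontalStrip.le {μ ν : YoungDiagram} (h : HorizontalStrip μ ν) : ν ≤ μ := by
  rintro ⟨i, j⟩ hc
  have hc' : (i, j) ∈ ν := hc
  change (i, j) ∈ μ
  rw [YoungDiagram.mem_iff_lt_rowLen] at *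
  exact hc'.trans_le (h i).1

theorem rowLen_injective {μ ν : YoungDiagram} (h : ∀ i, μ.rowLen i = ν.rowLen i) : μ = ν := by
  apply YoungDiagram.ext
  ext ⟨i, j⟩
  rw [YoungDiagram.mem_cells, YoungDiagram.mem_cells, YoungDiagram.mem_iff_lt_rowLen,
    YoungDiagram.mem_iff_lt_rowLen, h]

theorem rowLen_eq_zero_of_card_le (μ : YoungDiagram) {M : ℕ} (hM : μ.card ≤ M) :
    μ.rowLen M = 0 := by
  by_contra h0
  have hmem : (M, 0) ∈ μ := by
    rw [YoungDiagram.mem_iff_lt_rowLen]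
    omega
  have h1 : (Finset.range (M + 1)).map ⟨fun i => (i, 0), fun a b hab => by simpa using hab⟩ ⊆
      μ.cells := by
    intro c hc
    simp only [Finset.mem_map, Finset.mem_range] at hc
    obtain ⟨i, hi, rfl⟩ := hc
    exact μ.up_left_mem (by omega) le_rfl hmem
  have h2 := Finset.card_le_card h1
  rw [Finset.card_map, Finset.card_range] at h2
  change M + 1 ≤ μ.card at h2
  omega

theorem card_eq_sum_rowLen (μ : YoungDiagram) {M : ℕ} (hM : μ.rowLen M = 0) :
    μ.card = ∑ i ∈ Finset.range M, μ.rowLen i := by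
  have h1 : μ.cells = ((Finset.range M).sigma fun i => Finset.range (μ.rowLen i)).map
      (Equiv.sigmaEquivProd ℕ ℕ).toEmbedding := by
    ext ⟨i, j⟩
    simp only [YoungDiagram.mem_cells, YoungDiagram.mem_iff_lt_rowLen, Finset.mem_map_equiv,
      Finset.mem_sigma, Finset.mem_range, Equiv.sigmaEquivProd_symm_apply]
    refine ⟨fun h => ⟨?_, h⟩, fun h => h.2⟩
    by_contra hi
    have := μ.rowLen_anti M i (by omega)
    omega
  change μ.cells.card = _
  rw [h1, Finset.card_map, Finset.card_sigma]
  simp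

/-- The Young diagram with row lengths `f 0, f 1, …, f (M - 1)`. -/
def ofRows (f : ℕ → ℕ) (hf : Antitone f) (M : ℕ) : YoungDiagram where
  cells := (Finset.range M ×ˢ Finset.range (f 0)).filter fun c => c.2 < f c.1
  isLowerSet := by
    rintro ⟨i, j⟩ ⟨i', j'⟩ ⟨h1, h2⟩ hc
    simp only [Finset.coe_filter, Finset.mem_product, Finset.mem_range, Set.mem_ofPred_eq] at hc ⊢
    dsimp only at h1 h2
    have := hf h1
    omega

theorem rowLen_ofRows (f : ℕ → ℕ) (hf : Antitone f) (M : ℕ) (hM : f M = 0) (i : ℕ) :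
    (ofRows f hf M).rowLen i = f i := by
  have key : ∀ j, j < (ofRows f hf M).rowLen i ↔ j < f i := by
    intro j
    rw [← YoungDiagram.mem_iff_lt_rowLen, ← YoungDiagram.mem_cells]
    simp only [ofRows, Finset.mem_filter, Finset.mem_product, Finset.mem_range]
    refine ⟨fun h => h.2, fun h => ⟨⟨?_, h.trans_le (hf (Nat.zero_le i))⟩, h⟩⟩
    by_contra hi
    have := hf (not_lt.mp hi)
    omega
  have h1 := key (f i)
  have h2 := key ((ofRows f hf M).rowLen i)
  omega

/-! ### The local rule exchanging two horizontal strips. -/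

/-- Sum the relation over all rows and use `min + max = μ_i + ρ_i`; the shift of index leaves out
the first row of `κ` and the first maximum. Thus the size of `κ` fixes `κ.rowLen 0`, the one row
that the relation does not see. -/
theorem card_add_card_of_switch {μ ρ κ ν : YoungDiagram}
    (hs : ∀ i, κ.rowLen (i + 1) + ν.rowLen i =
      min (μ.rowLen i) (ρ.rowLen i) + max (μ.rowLen (i + 1)) (ρ.rowLen (i + 1))) :
    κ.card + ν.card + max (μ.rowLen 0) (ρ.rowLen 0) = κ.rowLen 0 + μ.card + ρ.card := by
  set M := μ.card + ρ.card + κ.card + ν.card with hM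
  have hμ := rowLen_eq_zero_of_card_le μ (M := M) (by omega)
  have hρ := rowLen_eq_zero_of_card_le ρ (M := M) (by omega)
  have hν := rowLen_eq_zero_of_card_le ν (M := M) (by omega)
  have hκ := rowLen_eq_zero_of_card_le κ (M := M + 1) (by omega)
  rw [card_eq_sum_rowLen μ hμ, card_eq_sum_rowLen ρ hρ, card_eq_sum_rowLen ν hν,
    card_eq_sum_rowLen κ hκ, Finset.sum_range_succ']
  have h1 : ∑ i ∈ Finset.range M, κ.rowLen (i + 1) + ∑ i ∈ Finset.range M, ν.rowLen i =
      ∑ i ∈ Finset.range M, min (μ.rowLen i) (ρ.rowLen i) +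
        ∑ i ∈ Finset.range M, max (μ.rowLen (i + 1)) (ρ.rowLen (i + 1)) := by
    rw [← Finset.sum_add_distrib, ← Finset.sum_add_distrib]
    exact Finset.sum_congr rfl fun i _ => hs i
  have h2 := Finset.sum_range_succ' (fun i => max (μ.rowLen i) (ρ.rowLen i)) M
  rw [Finset.sum_range_succ, hμ, hρ] at h2
  have h3 : ∑ i ∈ Finset.range M, min (μ.rowLen i) (ρ.rowLen i) +
      ∑ i ∈ Finset.range M, max (μ.rowLen i) (ρ.rowLen i) =
      ∑ i ∈ Finset.range M, μ.rowLen i + ∑ i ∈ Finset.range M, ρ.rowLen i := by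
    rw [← Finset.sum_add_distrib, ← Finset.sum_add_distrib]
    exact Finset.sum_congr rfl fun i _ => min_add_max _ _
  simp only [max_self] at h2
  omega

/-- The diagram `κ` of the local rule, determined by `ν` and the length of the first row of `κ`. -/
theorem exists_upper {μ ρ ν : YoungDiagram} (h1 : HorizontalStrip μ ν) (h2 : HorizontalStrip ρ ν)
    (a : ℕ) : ∃ κ : YoungDiagram, κ.rowLen 0 = max (μ.rowLen 0) (ρ.rowLen 0) + a ∧
      (∀ i, κ.rowLen (i + 1) + ν.rowLen i =
        min (μ.rowLen i) (ρ.rowLen i) + max (μ.rowLen (i + 1)) (ρ.rowLen (i + 1))) ∧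
      HorizontalStrip κ μ ∧ HorizontalStrip κ ρ := by
  -- Row `i + 1` of `κ` is the reflection of row `i` of `ν` in the interval from the larger of
  -- `μ_{i+1}, ρ_{i+1}` to the smaller of `μ_i, ρ_i`; row `0` is bounded only from below, hence the
  -- free parameter `a`.
  let f : ℕ → ℕ := fun i => Nat.casesOn i (max (μ.rowLen 0) (ρ.rowLen 0) + a) fun i =>
    min (μ.rowLen i) (ρ.rowLen i) + max (μ.rowLen (i + 1)) (ρ.rowLen (i + 1)) - ν.rowLen i
  have hf0 : f 0 = max (μ.rowLen 0) (ρ.rowLen 0) + a := rfl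
  have hfs : ∀ i, f (i + 1) + ν.rowLen i =
      min (μ.rowLen i) (ρ.rowLen i) + max (μ.rowLen (i + 1)) (ρ.rowLen (i + 1)) := by
    intro i
    have := h1 i
    have := h2 i
    change _ - _ + _ = _
    omega
  have hlow : ∀ i, max (μ.rowLen i) (ρ.rowLen i) ≤ f i := by
    rintro (_ | i)
    · omega
    · have := hfs i
      have := h1 i
      have := h2 i
      omega
  have hup : ∀ i, f (i + 1) ≤ min (μ.rowLen i) (ρ.rowLen i) := by
    intro i
    have := hfs i
    have := h1 i
    have := h2 i
    omega
  have hanti : Antitone f := antitone_nat_of_succ_le fun i => by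
    have := hup i
    have := hlow i
    omega
  have hz : f (μ.card + 1) = 0 := by
    have := hup μ.card
    rw [rowLen_eq_zero_of_card_le μ le_rfl] at this
    omega
  refine ⟨ofRows f hanti (μ.card + 1), ?_, ?_, ?_, ?_⟩
  · rw [rowLen_ofRows _ _ _ hz, hf0]
  · intro i
    rw [rowLen_ofRows _ _ _ hz, hfs]
  · intro i
    rw [rowLen_ofRows _ _ _ hz, rowLen_ofRows _ _ _ hz]
    have := hup i
    have := hlow i
    omega
  · intro i
    rw [rowLen_ofRows _ _ _ hz, rowLen_ofRows _ _ _ hz]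
    have := hup i
    have := hlow i
    omega

/-- The reflection of `exists_upper` is an involution on each interval, so the same formula recovers
`ν` from `κ`. -/
theorem exists_lower {μ ρ κ : YoungDiagram} (h1 : HorizontalStrip κ μ)
    (h2 : HorizontalStrip κ ρ) : ∃ ν : YoungDiagram,
      (∀ i, κ.rowLen (i + 1) + ν.rowLen i =
        min (μ.rowLen i) (ρ.rowLen i) + max (μ.rowLen (i + 1)) (ρ.rowLen (i + 1))) ∧
      HorizontalStrip μ ν ∧ HorizontalStrip ρ ν := by
  let f : ℕ → ℕ := fun i =>
    min (μ.rowLen i) (ρ.rowLen i) + max (μ.rowLen (i + 1)) (ρ.rowLen (i + 1)) - κ.rowLen (i + 1)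
  have hfs : ∀ i, κ.rowLen (i + 1) + f i =
      min (μ.rowLen i) (ρ.rowLen i) + max (μ.rowLen (i + 1)) (ρ.rowLen (i + 1)) := by
    intro i
    have := h1 i
    have := h2 i
    change _ + (_ - _) = _
    omega
  have hb : ∀ i, max (μ.rowLen (i + 1)) (ρ.rowLen (i + 1)) ≤ f i ∧
      f i ≤ min (μ.rowLen i) (ρ.rowLen i) := by
    intro i
    have := hfs i
    have := h1 i
    have := h2 i
    have := h1 (i + 1)
    have := h2 (i + 1)
    omega
  have hanti : Antitone f := antitone_nat_of_succ_le fun i => by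
    have := hb i
    have := hb (i + 1)
    omega
  have hz : f μ.card = 0 := by
    have := hb μ.card
    rw [rowLen_eq_zero_of_card_le μ le_rfl] at this
    omega
  refine ⟨ofRows f hanti μ.card, ?_, ?_, ?_⟩
  · intro i
    rw [rowLen_ofRows _ _ _ hz, hfs]
  · intro i
    rw [rowLen_ofRows _ _ _ hz]
    have := hb i
    omega
  · intro i
    rw [rowLen_ofRows _ _ _ hz]
    have := hb i
    omega

/-- The local rule behind the Pieri formula. -/
theorem nonempty_localRule (μ ρ : YoungDiagram) (m : ℕ) :
    Nonempty ({ν // HorizontalStrip μ ν ∧ HorizontalStrip ρ ν ∧ μ.card ≤ ν.card + m} ≃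
      {κ // HorizontalStrip κ μ ∧ HorizontalStrip κ ρ ∧ κ.card = ρ.card + m}) := by
  have hex : ∀ ν : {ν // HorizontalStrip μ ν ∧ HorizontalStrip ρ ν ∧ μ.card ≤ ν.card + m},
      ∃ κ : {κ // HorizontalStrip κ μ ∧ HorizontalStrip κ ρ ∧ κ.card = ρ.card + m},
        ∀ i, κ.1.rowLen (i + 1) + ν.1.rowLen i =
          min (μ.rowLen i) (ρ.rowLen i) + max (μ.rowLen (i + 1)) (ρ.rowLen (i + 1)) := by
    rintro ⟨ν, h1, h2, h3⟩
    -- The size identity turns `|κ| = |ρ| + m` into `a = |ν| + m - |μ|`; the bound `|μ| ≤ |ν| + m`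
    -- keeps this subtraction from truncating.
    obtain ⟨κ, hk0, hks, hk1, hk2⟩ := exists_upper h1 h2 (ν.card + m - μ.card)
    have := card_add_card_of_switch hks
    exact ⟨⟨κ, hk1, hk2, by omega⟩, hks⟩
  choose F hF using hex
  refine ⟨Equiv.ofBijective F ⟨fun ν ν' h => Subtype.ext (rowLen_injective fun i => ?_), ?_⟩⟩
  · have e1 := hF ν i
    have e2 := hF ν' i
    rw [h] at e1
    omega
  · rintro ⟨κ, h1, h2, h3⟩
    obtain ⟨ν, hs, hn1, hn2⟩ := exists_lower h1 h2
    have hc := card_add_card_of_switch hs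
    have := (h1 0).1
    have := (h2 0).1
    refine ⟨⟨ν, hn1, hn2, by omega⟩, Subtype.ext (rowLen_injective fun i => ?_)⟩
    -- The first row agrees because the sizes do, the others because of the row relation.
    rcases i with _ | i
    · have hc' := card_add_card_of_switch (hF ⟨ν, hn1, hn2, by omega⟩)
      have := (F ⟨ν, hn1, hn2, by omega⟩).2.2.2
      dsimp only at hc' ⊢
      omega
    · have e1 := hF ⟨ν, hn1, hn2, by omega⟩ i
      have e2 := hs i
      dsimp only at e1 ⊢
      omega

/-! ### Removing the largest letter from a tableau. -/

/-- Semistandard tableaux of shape `μ` with entries smaller than `N`. -/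
abbrev BoundedTableau (N : ℕ) (μ : YoungDiagram) : Type :=
  {T : SemistandardYoungTableau μ // ∀ c ∈ μ, T c.1 c.2 < N}

open Classical in
/-- Fill the cells of the horizontal strip `μ / ν` with the letter `N`. -/
def fillStrip {N : ℕ} {μ ν : YoungDiagram} (hμν : HorizontalStrip μ ν)
    (T : BoundedTableau N ν) : BoundedTableau (N + 1) μ where
  val :=
    { entry := fun i j => if (i, j) ∈ ν then T.1 i j else if (i, j) ∈ μ then N else 0
      row_weak' := by
        intro i j1 j2 hj hm
        have hm1 : (i, j1) ∈ μ := μ.up_left_mem le_rfl hj.le hm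
        by_cases h2 : (i, j2) ∈ ν
        · have h1 : (i, j1) ∈ ν := ν.up_left_mem le_rfl hj.le h2
          simpa [h1, h2] using T.1.row_weak hj h2
        · by_cases h1 : (i, j1) ∈ ν
          · simpa [h1, h2, hm] using (T.2 _ h1).le
          · simp [h1, h2, hm, hm1]
      col_strict' := by
        intro i1 i2 j hi hm
        by_cases h2 : (i2, j) ∈ ν
        · have h1 : (i1, j) ∈ ν := ν.up_left_mem hi.le le_rfl h2
          simpa [h1, h2] using T.1.col_strict hi h2
        · have h1 : (i1, j) ∈ ν := by
            rw [YoungDiagram.mem_iff_lt_rowLen] at hm ⊢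
            have := (hμν i1).2
            have := μ.rowLen_anti (i1 + 1) i2 hi
            omega
          simpa [h1, h2, hm] using T.2 _ h1
      zeros' := by
        intro i j hm
        have h1 : (i, j) ∉ ν := fun h => hm (hμν.le h)
        simp [h1, hm] }
  property := by
    rintro ⟨i, j⟩ hm
    change (if (i, j) ∈ ν then T.1 i j else if (i, j) ∈ μ then N else 0) < N + 1
    split_ifs with h1
    · exact (T.2 _ h1).trans (Nat.lt_succ_self N)
    · exact Nat.lt_succ_self N

open Classical in
theorem fillStrip_apply {N : ℕ} {μ ν : YoungDiagram} (hμν : HorizontalStrip μ ν)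
    (T : BoundedTableau N ν) (i j : ℕ) : (fillStrip hμν T).1 i j =
      if (i, j) ∈ ν then T.1 i j else if (i, j) ∈ μ then N else 0 := rfl

theorem fillStrip_lt_iff {N : ℕ} {μ ν : YoungDiagram} (hμν : HorizontalStrip μ ν)
    (T : BoundedTableau N ν) (i j : ℕ) :
    (i, j) ∈ ν ↔ (i, j) ∈ μ ∧ (fillStrip hμν T).1 i j < N := by
  rw [fillStrip_apply]
  by_cases h : (i, j) ∈ ν
  · have h' : (i, j) ∈ μ := hμν.le h
    simpa [h, h'] using T.2 _ h
  · simp +contextual [h]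

theorem content_fillStrip {N : ℕ} {μ ν : YoungDiagram} (hμν : HorizontalStrip μ ν)
    (T : BoundedTableau N ν) :
    content (fillStrip hμν T).1 = content T.1 + Finsupp.single N (μ.card - ν.card) := by
  have hsub : ν.cells ⊆ μ.cells := fun c hc => hμν.le hc
  rw [content, ← Finset.sum_sdiff hsub, add_comm]
  congr 1
  · refine Finset.sum_congr rfl fun c hc => ?_
    rw [fillStrip_apply, if_pos (show (c.1, c.2) ∈ ν from hc)]
  · rw [Finset.sum_congr rfl (g := fun _ => Finsupp.single N 1), Finset.sum_const,
      Finset.card_sdiff_of_subset hsub]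
    · simp [Finsupp.smul_single]
    · intro c hc
      rw [Finset.mem_sdiff] at hc
      rw [fillStrip_apply, if_neg (show (c.1, c.2) ∉ ν from hc.2),
        if_pos (show (c.1, c.2) ∈ μ from hc.1)]

/-- The inverse keeps the cells with entries below `N`. The cells containing `N` form a horizontal
strip because columns increase strictly. -/
theorem fillStrip_bijective (N : ℕ) (μ : YoungDiagram) :
    Function.Bijective fun p : (Σ ν : {ν // HorizontalStrip μ ν}, BoundedTableau N ν.1) =>
      fillStrip p.1.2 p.2 := by
  constructor
  · rintro ⟨⟨ν, hν⟩, T⟩ ⟨⟨ν', hν'⟩, T'⟩ h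
    dsimp only at h T T'
    have hνν : ν = ν' := by
      apply YoungDiagram.ext
      ext ⟨i, j⟩
      have h1 := fillStrip_lt_iff hν T i j
      have h2 := fillStrip_lt_iff hν' T' i j
      rw [h] at h1
      exact h1.trans h2.symm
    subst hνν
    congr 1
    apply Subtype.ext
    ext i j
    by_cases hc : (i, j) ∈ ν
    · have h1 := fillStrip_apply hν T i j
      rw [h, fillStrip_apply, if_pos hc, if_pos hc] at h1
      exact h1.symm
    · rw [T.1.zeros hc, T'.1.zeros hc]
  · intro T
    classical
    let ν : YoungDiagram :=
      { cells := μ.cells.filter fun c => T.1 c.1 c.2 < N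
        isLowerSet := by
          rintro ⟨i, j⟩ ⟨i', j'⟩ ⟨h1, h2⟩ hc
          dsimp only at h1 h2
          simp only [Finset.coe_filter, YoungDiagram.mem_cells, Set.mem_ofPred_eq] at hc ⊢
          refine ⟨μ.up_left_mem h1 h2 hc.1, ?_⟩
          have e1 := T.1.col_weak h1 hc.1
          have e2 := T.1.row_weak_of_le h2 (μ.up_left_mem h1 le_rfl hc.1)
          omega }
    have hmem : ∀ i j, (i, j) ∈ ν ↔ (i, j) ∈ μ ∧ T.1 i j < N := fun i j => by
      rw [← YoungDiagram.mem_cells]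
      simp [ν]
    have hν : HorizontalStrip μ ν := by
      intro i
      constructor
      · by_contra! hlt
        rw [← YoungDiagram.mem_iff_lt_rowLen, hmem, YoungDiagram.mem_iff_lt_rowLen] at hlt
        omega
      -- A cell of `μ` in row `i + 1` has an entry at most `N`, so the cell above it has an entry
      -- below `N` and belongs to `ν`.
      · by_contra! hlt
        rw [← YoungDiagram.mem_iff_lt_rowLen] at hlt
        have e1 := T.1.col_strict (i.lt_add_one) hlt
        have e2 := T.2 _ hlt
        have e3 : (i, ν.rowLen i) ∈ ν :=
          (hmem _ _).2 ⟨μ.up_left_mem (Nat.le_succ i) le_rfl hlt, by dsimp only at e2; omega⟩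
        rw [YoungDiagram.mem_iff_lt_rowLen] at e3
        omega
    let T' : SemistandardYoungTableau ν :=
      { entry := fun i j => if (i, j) ∈ ν then T.1 i j else 0
        row_weak' := by
          intro i j1 j2 hj h2
          have h1 : (i, j1) ∈ ν := ν.up_left_mem le_rfl hj.le h2
          simpa [h1, h2] using T.1.row_weak hj (hν.le h2)
        col_strict' := by
          intro i1 i2 j hi h2
          have h1 : (i1, j) ∈ ν := ν.up_left_mem hi.le le_rfl h2
          simpa [h1, h2] using T.1.col_strict hi (hν.le h2)
        zeros' := by
          intro i j h
          simp [h] }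
    have hT' : ∀ i j, T' i j = if (i, j) ∈ ν then T.1 i j else 0 := fun i j => rfl
    refine ⟨⟨⟨ν, hν⟩, ⟨T', ?_⟩⟩, ?_⟩
    · rintro ⟨i, j⟩ hc
      rw [hT', if_pos hc]
      exact ((hmem i j).1 hc).2
    · apply Subtype.ext
      ext i j
      rw [fillStrip_apply]
      dsimp only
      rw [hT']
      by_cases h1 : (i, j) ∈ ν
      · simp [h1]
      · by_cases h2 : (i, j) ∈ μ
        · have e1 := T.2 _ h2
          have e2 : ¬ T.1 i j < N := fun h => h1 ((hmem i j).2 ⟨h2, h⟩)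
          simp only [h1, h2, if_true, if_false]
          dsimp only at e1
          omega
        · simp only [h1, h2, if_false]
          exact (T.1.zeros h2).symm

theorem degree_content {μ : YoungDiagram} (T : SemistandardYoungTableau μ) :
    (content T).degree = μ.card := by
  rw [content, map_sum]
  simp

theorem content_apply_pos {μ : YoungDiagram} (T : SemistandardYoungTableau μ) {c : ℕ × ℕ}
    (hc : c ∈ μ) : 0 < content T (T c.1 c.2) := by
  rw [content, Finsupp.finsetSum_apply]
  have := Finset.single_le_sum (f := fun c' : ℕ × ℕ =>
    (Finsupp.single (T c'.1 c'.2) 1 : ℕ →₀ ℕ) (T c.1 c.2)) (fun _ _ => Nat.zero_le _)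
    ((YoungDiagram.mem_cells c).2 hc)
  simp only [Finsupp.single_eq_same] at this
  omega

theorem content_apply_eq_zero {N : ℕ} {μ : YoungDiagram} (T : BoundedTableau N μ) {n : ℕ}
    (hn : N ≤ n) : content T.1 n = 0 := by
  rw [content, Finsupp.finsetSum_apply]
  refine Finset.sum_eq_zero fun c hc => ?_
  have := T.2 c hc
  rw [Finsupp.single_apply, if_neg (by omega)]

theorem lt_of_content_le {N : ℕ} {μ : YoungDiagram} {T : SemistandardYoungTableau μ} {d : ℕ →₀ ℕ}
    (hd : ∀ n, N ≤ n → d n = 0) (hT : content T ≤ d) : ∀ c ∈ μ, T c.1 c.2 < N := by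
  intro c hc
  by_contra! hlt
  have h1 := content_apply_pos T hc
  have h2 := hT (T c.1 c.2)
  have h3 := hd _ hlt
  omega

theorem content_fillStrip_le_iff {N : ℕ} {μ ν : YoungDiagram} (hμν : HorizontalStrip μ ν)
    (T : BoundedTableau N ν) (d : ℕ →₀ ℕ) : content (fillStrip hμν T).1 ≤ d ↔
      content T.1 ≤ d.erase N ∧ μ.card ≤ ν.card + d N := by
  rw [content_fillStrip]
  have h0 := content_apply_eq_zero T le_rfl
  constructor
  · intro h
    refine ⟨fun n => ?_, ?_⟩
    · have := h n
      by_cases hn : n = N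
      · subst hn
        simp [h0]
      · rw [Finsupp.erase_ne hn]
        simpa [hn] using this
    · have := h N
      simp only [Finsupp.add_apply, Finsupp.single_eq_same, h0] at this
      omega
  · rintro ⟨h1, h2⟩ n
    have := h1 n
    by_cases hn : n = N
    · subst hn
      simp only [Finsupp.add_apply, Finsupp.single_eq_same, h0]
      omega
    · rw [Finsupp.erase_ne hn] at this
      simpa [hn] using this

theorem content_fillStrip_eq_iff {N : ℕ} {μ ν : YoungDiagram} (hμν : HorizontalStrip μ ν)
    (T : BoundedTableau N ν) (d : ℕ →₀ ℕ) : content (fillStrip hμν T).1 = d ↔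
      content T.1 = d.erase N ∧ μ.card = ν.card + d N := by
  rw [content_fillStrip]
  have h0 := content_apply_eq_zero T le_rfl
  have hle : ν.card ≤ μ.card := Finset.card_le_card fun c hc => hμν.le hc
  constructor
  · rintro rfl
    refine ⟨?_, ?_⟩
    · ext n
      by_cases hn : n = N
      · subst hn
        simp [h0]
      · rw [Finsupp.erase_ne hn]
        simp [hn]
    · simp only [Finsupp.add_apply, Finsupp.single_eq_same, h0]
      omega
  · rintro ⟨h1, h2⟩
    rw [h1, h2, Nat.add_sub_cancel_left, add_comm, Finsupp.single_add_erase]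

theorem eq_bot_of_boundedTableau_zero {μ : YoungDiagram} (T : BoundedTableau 0 μ) : μ = ⊥ := by
  apply YoungDiagram.ext
  ext c
  simpa using fun hc => Nat.not_lt_zero _ (T.2 c hc)

theorem horizontalStrip_self (μ : YoungDiagram) : HorizontalStrip μ μ :=
  fun i => ⟨le_rfl, μ.rowLen_anti i (i + 1) (Nat.le_succ i)⟩

instance subsingleton_tableau_bot : Subsingleton (SemistandardYoungTableau ⊥) :=
  ⟨fun T T' => by
    ext i j
    rw [T.zeros (YoungDiagram.notMem_bot _), T'.zeros (YoungDiagram.notMem_bot _)]⟩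

/-- Splitting off the largest letter. -/
theorem nonempty_equiv_le (N : ℕ) (μ : YoungDiagram) (d : ℕ →₀ ℕ) :
    Nonempty ({T : BoundedTableau (N + 1) μ // content T.1 ≤ d} ≃
      Σ ν : {ν // HorizontalStrip μ ν ∧ μ.card ≤ ν.card + d N},
        {T : BoundedTableau N ν.1 // content T.1 ≤ d.erase N}) := by
  refine ⟨(((Equiv.ofBijective _ (fillStrip_bijective N μ)).subtypeEquiv (p := fun p =>
    content p.2.1 ≤ d.erase N ∧ μ.card ≤ p.1.1.card + d N)
    fun p => (content_fillStrip_le_iff p.1.2 p.2 d).symm).symm).trans ?_⟩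
  exact
    { toFun := fun p => ⟨⟨p.1.1.1, p.1.1.2, p.2.2⟩, ⟨p.1.2, p.2.1⟩⟩
      invFun := fun p => ⟨⟨⟨p.1.1, p.1.2.1⟩, p.2.1⟩, p.2.2, p.1.2.2⟩
      left_inv := fun _ => rfl
      right_inv := fun _ => rfl }

theorem nonempty_equiv_eq (N : ℕ) (μ : YoungDiagram) (d : ℕ →₀ ℕ) :
    Nonempty ({T : BoundedTableau (N + 1) μ // content T.1 = d} ≃
      Σ ν : {ν // HorizontalStrip μ ν ∧ μ.card = ν.card + d N},
        {T : BoundedTableau N ν.1 // content T.1 = d.erase N}) := by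
  refine ⟨(((Equiv.ofBijective _ (fillStrip_bijective N μ)).subtypeEquiv (p := fun p =>
    content p.2.1 = d.erase N ∧ μ.card = p.1.1.card + d N)
    fun p => (content_fillStrip_eq_iff p.1.2 p.2 d).symm).symm).trans ?_⟩
  exact
    { toFun := fun p => ⟨⟨p.1.1.1, p.1.1.2, p.2.2⟩, ⟨p.1.2, p.2.1⟩⟩
      invFun := fun p => ⟨⟨⟨p.1.1, p.1.2.1⟩, p.2.1⟩, p.2.2, p.1.2.2⟩
      left_inv := fun _ => rfl
      right_inv := fun _ => rfl }

/-! ### The Pieri formula. -/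

/-- The bijective form of the Pieri formula: a tableau of shape `μ` together with a complement of
its content in `d` corresponds to a tableau of content `d` whose shape is `μ` plus a horizontal
strip. -/
theorem nonempty_pieri_equiv (N : ℕ) : ∀ (μ : YoungDiagram) (d : ℕ →₀ ℕ),
    (∀ n, N ≤ n → d n = 0) →
    Nonempty ({T : BoundedTableau N μ // content T.1 ≤ d} ≃
      Σ κ : {κ // HorizontalStrip κ μ}, {T : BoundedTableau N κ.1 // content T.1 = d}) := by
  induction N with
  | zero =>
    intro μ d hd
    obtain rfl : d = 0 := Finsupp.ext fun n => hd n (Nat.zero_le n)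
    have h1 : Subsingleton {T : BoundedTableau 0 μ // content T.1 ≤ 0} := by
      refine ⟨fun T T' => ?_⟩
      obtain rfl := eq_bot_of_boundedTableau_zero T.1
      exact Subtype.ext (Subsingleton.elim _ _)
    have h2 : Subsingleton (Σ κ : {κ // HorizontalStrip κ μ},
        {T : BoundedTableau 0 κ.1 // content T.1 = 0}) := by
      refine ⟨?_⟩
      rintro ⟨⟨κ, hκ⟩, T⟩ ⟨⟨κ', hκ'⟩, T'⟩
      obtain rfl := eq_bot_of_boundedTableau_zero T.1
      obtain rfl := eq_bot_of_boundedTableau_zero T'.1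
      congr 1
      exact Subtype.ext (Subsingleton.elim _ _)
    refine ⟨@equivOfSubsingletonOfSubsingleton _ _ h1 h2
      (fun T => ⟨⟨μ, horizontalStrip_self μ⟩, ⟨T.1, nonpos_iff_eq_zero.1 T.2⟩⟩) fun p => ?_⟩
    -- Without letters only the empty shape has a tableau, so `κ` and its subdiagram `μ` are both
    -- empty.
    have hb : p.1.1 = ⊥ := eq_bot_of_boundedTableau_zero p.2.1
    have hμ : p.1.1 = μ := by
      rw [hb]
      exact (le_bot_iff.1 (hb ▸ p.1.2.le)).symm
    exact hμ ▸ ⟨p.2.1, p.2.2.le⟩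
  | succ N ih =>
    intro μ d hd
    have hd' : ∀ n, N ≤ n → d.erase N n = 0 := by
      intro n hn
      by_cases h : n = N
      · rw [h, Finsupp.erase_same]
      · rw [Finsupp.erase_ne h, hd n (by omega)]
    obtain ⟨e1⟩ := nonempty_equiv_le N μ d
    have e2 := fun κ => Classical.choice (nonempty_equiv_eq N κ d)
    have e3 := fun ν => Classical.choice (ih ν (d.erase N) hd')
    have e4 := fun ρ => Classical.choice (nonempty_localRule μ ρ (d N))
    let B : YoungDiagram → Type := fun ρ => {T : BoundedTableau N ρ // content T.1 = d.erase N}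
    -- One column of a growth diagram: remove the letter `N` to pass from `μ` to `ν`, grow `ν` to
    -- `ρ` by induction, complete the square `ν, μ, ρ` to `κ` by the local rule, and fill `κ / ρ`
    -- with `N`. The two reorderings below only regroup the data of the square.
    refine ⟨e1.trans <| Equiv.trans (β := Σ ν : {ν // HorizontalStrip μ ν ∧ μ.card ≤ ν.card + d N},
        Σ ρ : {ρ // HorizontalStrip ρ ν.1}, B ρ.1) (Equiv.sigmaCongrRight fun ν => e3 ν.1) <|
      Equiv.trans (β := Σ ρ : YoungDiagram,
        {ν // HorizontalStrip μ ν ∧ HorizontalStrip ρ ν ∧ μ.card ≤ ν.card + d N} × B ρ) ?_ <|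
      (Equiv.sigmaCongrRight fun ρ => (e4 ρ).prodCongr (Equiv.refl (B ρ))).trans <|
      Equiv.trans (β := Σ κ : {κ // HorizontalStrip κ μ},
        Σ ρ : {ρ // HorizontalStrip κ.1 ρ ∧ κ.1.card = ρ.card + d N}, B ρ.1) ?_
        (Equiv.sigmaCongrRight fun κ => (e2 κ.1).symm)⟩
    · exact
        { toFun := fun p => ⟨p.2.1.1, ⟨p.1.1, p.1.2.1, p.2.1.2, p.1.2.2⟩, p.2.2⟩
          invFun := fun p => ⟨⟨p.2.1.1, p.2.1.2.1, p.2.1.2.2.2⟩, ⟨p.1, p.2.1.2.2.1⟩, p.2.2⟩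
          left_inv := fun _ => rfl
          right_inv := fun _ => rfl }
    · exact
        { toFun := fun p => ⟨⟨p.2.1.1, p.2.1.2.1⟩, ⟨p.1, p.2.1.2.2⟩, p.2.2⟩
          invFun := fun p => ⟨p.2.1.1, ⟨p.1.1, p.1.2, p.2.1.2⟩, p.2.2⟩
          left_inv := fun _ => rfl
          right_inv := fun _ => rfl }

theorem nonempty_pieri_equiv_tableau (μ : YoungDiagram) (d : ℕ →₀ ℕ) :
    Nonempty ({T : SemistandardYoungTableau μ // content T ≤ d} ≃
      Σ κ : {κ // HorizontalStrip κ μ}, {T : SemistandardYoungTableau κ.1 // content T = d}) := by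
  have hd : ∀ n, d.support.sup id + 1 ≤ n → d n = 0 := by
    intro n hn
    by_contra h
    have := Finset.le_sup (f := id) (Finsupp.mem_support_iff.2 h)
    simp only [id] at this hn
    omega
  obtain ⟨e⟩ := nonempty_pieri_equiv _ μ d hd
  refine ⟨Equiv.trans ?_ <| e.trans <| Equiv.sigmaCongrRight fun κ => ?_⟩
  · exact
      { toFun := fun T => ⟨⟨T.1, lt_of_content_le hd T.2⟩, T.2⟩
        invFun := fun T => ⟨T.1.1, T.2⟩
        left_inv := fun _ => rfl
        right_inv := fun _ => rfl }
  · exact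
      { toFun := fun T => ⟨T.1.1, T.2⟩
        invFun := fun T => ⟨⟨T.1, lt_of_content_le hd T.2.le⟩, T.2⟩
        left_inv := fun _ => rfl
        right_inv := fun _ => rfl }

/-- A diagram with `n` cells fits in an `n × n` box. -/
theorem finite_setOf_card_eq (n : ℕ) : {κ : YoungDiagram | κ.card = n}.Finite := by
  refine Set.Finite.of_finite_image (f := YoungDiagram.cells)
    ((Finset.finite_toSet (Finset.range n ×ˢ Finset.range n).powerset).subset ?_)
    fun κ _ κ' _ h => YoungDiagram.ext h
  rintro _ ⟨κ, rfl, rfl⟩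
  rw [Finset.mem_coe, Finset.mem_powerset]
  rintro ⟨i, j⟩ hc
  rw [YoungDiagram.mem_cells, YoungDiagram.mem_iff_lt_rowLen] at hc
  have hi : i < κ.card := by
    by_contra! hi
    rw [rowLen_eq_zero_of_card_le κ hi] at hc
    omega
  have hrow : κ.rowLen i ≤ κ.card := by
    rw [YoungDiagram.rowLen_eq_card]
    exact Finset.card_le_card (Finset.filter_subset _ _)
  simp only [Finset.mem_product, Finset.mem_range]
  omega

open Classical in
/-- The diagrams obtained from `μ` by adding a horizontal strip of size `n`. -/
def addStrip (μ : YoungDiagram) (n : ℕ) : Finset YoungDiagram :=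
  (finite_setOf_card_eq (μ.card + n)).toFinset.filter fun κ => HorizontalStrip κ μ

theorem mem_addStrip {μ κ : YoungDiagram} {n : ℕ} :
    κ ∈ addStrip μ n ↔ κ.card = μ.card + n ∧ HorizontalStrip κ μ := by
  simp [addStrip]

theorem coeff_schur (μ : YoungDiagram) (d : ℕ →₀ ℕ) : MvPowerSeries.coeff d (schur μ) =
    (Nat.card {T : SemistandardYoungTableau μ // content T = d} : ℝ) := rfl

theorem coeff_schur_eq_zero {μ : YoungDiagram} {d : ℕ →₀ ℕ} (hd : d.degree ≠ μ.card) :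
    MvPowerSeries.coeff d (schur μ) = 0 := by
  rw [coeff_schur]
  have : IsEmpty {T : SemistandardYoungTableau μ // content T = d} :=
    ⟨fun T => hd (by rw [← T.2, degree_content])⟩
  simp

theorem coeff_h (n : ℕ) (d : ℕ →₀ ℕ) : MvPowerSeries.coeff d (toSeries (h n)) =
    if d.degree = n then 1 else 0 := rfl

/-- The Pieri formula. -/
theorem h_mul_schur (n : ℕ) (μ : YoungDiagram) :
    toSeries (h n) * schur μ = ∑ κ ∈ addStrip μ n, schur κ := by
  ext d
  rw [MvPowerSeries.coeff_mul, map_sum]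
  by_cases hd : d.degree = μ.card + n
  -- In this degree the factor from `h_n` is `1` whenever the Schur coefficient is nonzero, so the
  -- product counts tableaux of shape `μ` with content at most `d`.
  · have h1 : ∀ p ∈ Finset.HasAntidiagonal.antidiagonal d,
        MvPowerSeries.coeff p.1 (toSeries (h n)) * MvPowerSeries.coeff p.2 (schur μ) =
        MvPowerSeries.coeff p.2 (schur μ) := by
      intro p hp
      by_cases hp2 : p.2.degree = μ.card
      · have h2 : p.1.degree + p.2.degree = d.degree := by
          rw [← map_add, Finset.HasAntidiagonal.mem_antidiagonal.mp hp]
        rw [coeff_h, if_pos (by omega), one_mul]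
      · rw [coeff_schur_eq_zero hp2, mul_zero]
    rw [Finset.sum_congr rfl h1]
    simp only [coeff_schur]
    rw [← Nat.cast_sum, ← Nat.cast_sum]
    congr 1
    obtain ⟨e⟩ := nonempty_pieri_equiv_tableau μ d
    have := finite_tableaux
    rw [← Finset.sum_coe_sort, ← Finset.sum_coe_sort (addStrip μ n), ← Nat.card_sigma,
      ← Nat.card_sigma]
    refine Nat.card_congr (Equiv.trans ?_ (e.trans ?_))
    · exact
        { toFun := fun p => ⟨p.2.1, by
            exact p.2.2.trans_le (le_of_le_of_eq le_add_self
              (Finset.HasAntidiagonal.mem_antidiagonal.mp p.1.2))⟩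
          invFun := fun T => ⟨⟨(d - content T.1, content T.1), by
            rw [Finset.HasAntidiagonal.mem_antidiagonal]
            exact tsub_add_cancel_of_le T.2⟩, ⟨T.1, rfl⟩⟩
          left_inv := by
            rintro ⟨⟨⟨a, b⟩, hp⟩, ⟨T, hT⟩⟩
            obtain rfl : a + b = d := Finset.HasAntidiagonal.mem_antidiagonal.mp hp
            obtain rfl : b = content T := hT.symm
            simp
          right_inv := fun _ => rfl }
    · exact
        { toFun := fun p => ⟨⟨p.1.1, mem_addStrip.2
            ⟨((degree_content p.2.1).symm.trans (congrArg _ p.2.2)).trans hd, p.1.2⟩⟩, p.2⟩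
          invFun := fun p => ⟨⟨p.1.1, (mem_addStrip.1 p.1.2).2⟩, p.2⟩
          left_inv := fun _ => rfl
          right_inv := fun _ => rfl }
  · rw [Finset.sum_eq_zero, Finset.sum_eq_zero]
    · intro κ hκ
      exact coeff_schur_eq_zero (by rw [(mem_addStrip.1 hκ).1]; exact hd)
    · intro p hp
      have h2 : p.1.degree + p.2.degree = d.degree := by
        rw [← map_add, Finset.HasAntidiagonal.mem_antidiagonal.mp hp]
      by_cases hp2 : p.2.degree = μ.card
      · rw [coeff_h, if_neg (by omega), zero_mul]
      · rw [coeff_schur_eq_zero hp2, mul_zero]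

theorem schur_bot : schur ⊥ = 1 := by
  ext d
  rw [coeff_schur, MvPowerSeries.coeff_one]
  have h0 : ∀ T : SemistandardYoungTableau ⊥, content T = 0 := fun T => by simp [content]
  split_ifs with hd
  · subst hd
    have : Unique {T : SemistandardYoungTableau ⊥ // content T = 0} :=
      { default := ⟨⟨fun _ _ => 0, by simp, by simp, by simp⟩, h0 _⟩
        uniq := fun _ => Subtype.ext (Subsingleton.elim _ _) }
    simp
  · have : IsEmpty {T : SemistandardYoungTableau ⊥ // content T = d} :=
      ⟨fun T => hd (by rw [← T.2, h0])⟩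
    simp

/-! ### The cone of Schur-positive functions. -/

theorem SchurPositive.zero : SchurPositive 0 := ⟨0, fun _ => le_rfl, by simp⟩

theorem SchurPositive.add {f g : Lam} (hf : SchurPositive f) (hg : SchurPositive g) :
    SchurPositive (f + g) := by
  obtain ⟨c, hc, hf⟩ := hf
  obtain ⟨c', hc', hg⟩ := hg
  refine ⟨c + c', fun μ => add_nonneg (hc μ) (hc' μ), ?_⟩
  rw [map_add, hf, hg, Finsupp.sum_add_index'] <;> simp [add_smul]

theorem SchurPositive.sum {ι : Type*} (s : Finset ι) {f : ι → Lam}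
    (hf : ∀ i ∈ s, SchurPositive (f i)) : SchurPositive (∑ i ∈ s, f i) :=
  Finset.sum_induction _ _ (fun _ _ => SchurPositive.add) SchurPositive.zero hf

theorem schurPositive_of_eq_sum {f : Lam} {s : Finset YoungDiagram}
    (hf : toSeries f = ∑ κ ∈ s, schur κ) : SchurPositive f := by
  classical
  refine ⟨∑ κ ∈ s, Finsupp.single κ 1, fun μ => ?_, ?_⟩
  · rw [Finsupp.finsetSum_apply]
    refine Finset.sum_nonneg fun κ _ => ?_
    rw [Finsupp.single_apply]
    split_ifs <;> norm_num
  · rw [hf, ← Finsupp.sum_finsetSum_index (by simp) (by simp [add_smul])]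
    simp

theorem SchurPositive.h_mul {f : Lam} (hf : SchurPositive f) (n : ℕ) :
    SchurPositive (h n * f) := by
  classical
  obtain ⟨c, hc, hf⟩ := hf
  refine ⟨∑ μ ∈ c.support, ∑ κ ∈ addStrip μ n, Finsupp.single κ (c μ), fun μ => ?_, ?_⟩
  · simp only [Finsupp.finsetSum_apply]
    refine Finset.sum_nonneg fun ν _ => Finset.sum_nonneg fun κ _ => ?_
    rw [Finsupp.single_apply]
    split_ifs
    exacts [hc ν, le_rfl]
  · rw [← Finsupp.sum_finsetSum_index (by simp) (by simp [add_smul]), map_mul, hf, Finsupp.sum,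
      Finset.mul_sum]
    refine Finset.sum_congr rfl fun μ _ => ?_
    rw [← Finsupp.sum_finsetSum_index (by simp) (by simp [add_smul]), mul_smul_comm, h_mul_schur,
      Finset.smul_sum]
    simp

/-! ### Products of two complete homogeneous functions. -/

/-- The diagram with a single row, of length `a`. -/
def oneRow (a : ℕ) : YoungDiagram :=
  ofRows (fun i => if i = 0 then a else 0) (antitone_nat_of_succ_le fun i => by simp) 1

theorem rowLen_oneRow (a i : ℕ) : (oneRow a).rowLen i = if i = 0 then a else 0 :=
  rowLen_ofRows _ _ 1 (by simp) i

theorem card_oneRow (a : ℕ) : (oneRow a).card = a := by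
  rw [card_eq_sum_rowLen (oneRow a) (M := 1) (by simp [rowLen_oneRow])]
  simp [rowLen_oneRow]

theorem rowLen_bot (i : ℕ) : (⊥ : YoungDiagram).rowLen i = 0 := by
  by_contra h
  exact YoungDiagram.notMem_bot (i, 0) (YoungDiagram.mem_iff_lt_rowLen.2 (by omega))

theorem addStrip_bot (a : ℕ) : addStrip ⊥ a = {oneRow a} := by
  ext κ
  rw [mem_addStrip, Finset.mem_singleton]
  have hb : (⊥ : YoungDiagram).card = 0 := rfl
  rw [hb, zero_add]
  constructor
  · rintro ⟨h1, h2⟩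
    have h3 : ∀ i, κ.rowLen (i + 1) = 0 := fun i => by
      have := (h2 i).2
      rw [rowLen_bot] at this
      omega
    have h4 := card_eq_sum_rowLen κ (h3 0)
    rw [h1] at h4
    refine rowLen_injective fun i => ?_
    rw [rowLen_oneRow]
    rcases i with _ | i
    · simp [h4]
    · simp [h3]
  · rintro rfl
    refine ⟨card_oneRow a, fun i => ?_⟩
    simp [rowLen_bot, rowLen_oneRow]

theorem toSeries_h (a : ℕ) : toSeries (h a) = schur (oneRow a) := by
  have := h_mul_schur a ⊥
  rwa [schur_bot, mul_one, addStrip_bot, Finset.sum_singleton] at this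

theorem schurPositive_h (a : ℕ) : SchurPositive (h a) :=
  schurPositive_of_eq_sum (s := {oneRow a}) (by rw [toSeries_h, Finset.sum_singleton])

theorem toSeries_h_mul_h (a b : ℕ) :
    toSeries (h a * h b) = ∑ κ ∈ addStrip (oneRow b) a, schur κ := by
  rw [map_mul, toSeries_h b, h_mul_schur]

/-- The point is that `κ_1 ≤ b`: since `κ_0 ≥ b + 1` and `κ_0 + κ_1 = a + b + 1`, the second row has
length at most `a ≤ b`. -/
theorem addStrip_oneRow_subset {a b : ℕ} (hab : a ≤ b) :
    addStrip (oneRow (b + 1)) a ⊆ addStrip (oneRow b) (a + 1) := by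
  intro κ
  rw [mem_addStrip, mem_addStrip, card_oneRow, card_oneRow]
  rintro ⟨h1, h2⟩
  refine ⟨by omega, fun i => ?_⟩
  have e0 := h2 0
  have e1 := h2 1
  have e2 := h2 i
  have hz : κ.rowLen 2 = 0 := by
    rw [rowLen_oneRow] at e1
    simpa using e1.2
  have hc := card_eq_sum_rowLen κ hz
  rw [Finset.sum_range_succ, Finset.sum_range_one] at hc
  rw [rowLen_oneRow] at e0 e2 ⊢
  rcases i with _ | i
  · simp only [if_true, zero_add] at *
    omega
  · simpa using e2

/-- The two-row Schur function `h_b h_{a+1} - h_{b+1} h_a` is Schur-positive. -/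
theorem schurLE_h_mul_h {a b : ℕ} (hab : a ≤ b) :
    SchurLE (h a * h (b + 1)) (h (a + 1) * h b) := by
  classical
  refine schurPositive_of_eq_sum
    (s := addStrip (oneRow b) (a + 1) \ addStrip (oneRow (b + 1)) a) ?_
  rw [map_sub, toSeries_h_mul_h, toSeries_h_mul_h,
    ← Finset.sum_sdiff (addStrip_oneRow_subset hab), add_sub_cancel_right]

/-! ### Geometric sums and the cone of centered combinations. -/

open Polynomial

/-- The geometric sum `[k] = 1 + t + ⋯ + t^(k-1)`. -/
def bracket (k : ℕ) : Polynomial Lam := ∑ i ∈ Finset.range k, X ^ i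

theorem bracket_zero : bracket 0 = 0 := Finset.sum_range_zero _

theorem bracket_succ (k : ℕ) : bracket (k + 1) = bracket k + X ^ k := Finset.sum_range_succ _ _

theorem bracket_succ' (k : ℕ) : bracket (k + 1) = 1 + X * bracket k := by
  rw [bracket, Finset.sum_range_succ', pow_zero, add_comm, bracket, Finset.mul_sum]
  simp only [pow_succ']

theorem bracket_add (a b : ℕ) : bracket (a + b) = bracket b + X ^ b * bracket a := by
  induction a with
  | zero => simp [bracket_zero]
  | succ a ih =>
    rw [add_right_comm, bracket_succ, ih, bracket_succ, pow_add]
    ring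

/-- One step of the Clebsch–Gordan rule: the longest centered sum splits off, leaving a smaller
product with the same center. -/
theorem bracket_mul_bracket (a b : ℕ) :
    bracket (a + 1) * bracket (b + 1) = bracket (a + b + 1) + X * (bracket a * bracket b) := by
  have h1 := bracket_succ' a
  have h2 := bracket_succ b
  have h3 := bracket_add (a + 1) b
  rw [show a + b + 1 = a + 1 + b by ring, h3]
  linear_combination bracket (b + 1) * h1 + (X * bracket a + 1) * h2 - X ^ b * h1

theorem coeff_X_pow_mul_bracket (i k j : ℕ) :
    (X ^ i * bracket k).coeff j = if i ≤ j ∧ j < i + k then 1 else 0 := by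
  rw [coeff_X_pow_mul']
  simp only [bracket, finsetSum_coeff, coeff_X_pow, Finset.sum_ite_eq, Finset.mem_range]
  by_cases hij : i ≤ j
  · simp only [hij, if_true, true_and]
    congr 1
    apply propext
    omega
  · simp [hij]

/-- The polynomials `∑ c_i t^i [m + 1 - 2i]` with Schur-positive coefficients `c_i`. -/
def symmetricUnimodal (m : ℕ) : AddSubmonoid (Polynomial Lam) :=
  AddSubmonoid.closure
    {A | ∃ (c : Lam) (i j : ℕ), SchurPositive c ∧ 2 * i + j = m ∧ A = C c * (X ^ i * bracket (j + 1))}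

theorem mem_symmetricUnimodal {c : Lam} (hc : SchurPositive c) (i j : ℕ) {m : ℕ}
    (hm : 2 * i + j = m) : C c * (X ^ i * bracket (j + 1)) ∈ symmetricUnimodal m :=
  AddSubmonoid.subset_closure ⟨c, i, j, hc, hm, rfl⟩

theorem symmetricUnimodal_le_comap {m k : ℕ} (φ : Polynomial Lam →+ Polynomial Lam)
    (h : ∀ (c : Lam) (i j : ℕ), SchurPositive c → 2 * i + j = m →
      φ (C c * (X ^ i * bracket (j + 1))) ∈ symmetricUnimodal k) {A : Polynomial Lam}
    (hA : A ∈ symmetricUnimodal m) : φ A ∈ symmetricUnimodal k := by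
  have : symmetricUnimodal m ≤ (symmetricUnimodal k).comap φ := by
    rw [symmetricUnimodal, AddSubmonoid.closure_le]
    rintro _ ⟨c, i, j, hc, hm, rfl⟩
    exact h c i j hc hm
  exact this hA

theorem X_mul_mem_symmetricUnimodal {m : ℕ} {A : Polynomial Lam} (hA : A ∈ symmetricUnimodal m) :
    X * A ∈ symmetricUnimodal (m + 2) := by
  refine symmetricUnimodal_le_comap (AddMonoidHom.mulLeft X) (fun c i j hc hm => ?_) hA
  have := mem_symmetricUnimodal hc (i + 1) j (m := m + 2) (by omega)
  convert this using 1
  simp only [AddMonoidHom.coe_mulLeft, pow_succ]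
  ring

theorem h_mul_mem_symmetricUnimodal {m : ℕ} {A : Polynomial Lam} (hA : A ∈ symmetricUnimodal m)
    (n : ℕ) : C (h n) * A ∈ symmetricUnimodal m := by
  refine symmetricUnimodal_le_comap (AddMonoidHom.mulLeft (C (h n))) (fun c i j hc hm => ?_) hA
  have := mem_symmetricUnimodal (hc.h_mul n) i j hm
  convert this using 1
  simp only [AddMonoidHom.coe_mulLeft, C_mul]
  ring

theorem C_mul_X_pow_mul_bracket_mul_bracket_mem {c : Lam} (hc : SchurPositive c) (a : ℕ) :
    ∀ (i b m : ℕ), 2 * i + a + b = m →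
      C c * (X ^ i * (bracket (a + 1) * bracket (b + 1))) ∈ symmetricUnimodal m := by
  induction a with
  | zero =>
    intro i b m hm
    have := mem_symmetricUnimodal hc i b (m := m) (by omega)
    rwa [bracket_succ' 0, bracket_zero, mul_zero, add_zero, one_mul]
  | succ a ih =>
    intro i b m hm
    rw [bracket_mul_bracket, mul_add, mul_add]
    refine add_mem (mem_symmetricUnimodal hc i _ (by omega)) ?_
    rcases b with _ | b
    · simp only [bracket_zero, mul_zero]
      exact zero_mem _
    · have := ih (i + 1) b m (by omega)
      rwa [pow_succ, mul_assoc] at this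

theorem mul_bracket_mem_symmetricUnimodal {m : ℕ} {A : Polynomial Lam}
    (hA : A ∈ symmetricUnimodal m) (k : ℕ) :
    A * bracket (k + 1) ∈ symmetricUnimodal (m + k) := by
  refine symmetricUnimodal_le_comap (AddMonoidHom.mulRight (bracket (k + 1)))
    (fun c i j hc hm => ?_) hA
  have := C_mul_X_pow_mul_bracket_mul_bracket_mem hc j i k (m + k) (by omega)
  simpa only [AddMonoidHom.coe_mulRight, mul_assoc] using this

/-- A palindromic sequence that increases up to its middle gives a combination of centered
geometric sums. -/
theorem sum_mem_symmetricUnimodal (m : ℕ) : ∀ w : ℕ → Lam, SchurPositive (w 0) →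
    (∀ j ≤ m, w (m - j) = w j) → (∀ j, 2 * j + 2 ≤ m → SchurLE (w j) (w (j + 1))) →
    ∑ j ∈ Finset.range (m + 1), C (w j) * X ^ j ∈ symmetricUnimodal m := by
  induction m using Nat.strong_induction_on with
  | _ m ih =>
    intro w h0 hp hu
    have hbase : C (w 0) * bracket (m + 1) ∈ symmetricUnimodal m := by
      simpa using mem_symmetricUnimodal h0 0 m (m := m) (by omega)
    rcases m with _ | _ | m
    · simpa [bracket] using hbase
    · have h1 : w 1 = w 0 := by simpa using hp 0
      simpa [bracket, Finset.sum_range_succ, h1, mul_add] using hbase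
    · have hm : w (m + 2) = w 0 := by simpa using hp 0
      -- Subtracting `w 0 * [m + 3]` removes both end terms; dividing by `t` leaves a sequence of
      -- the same kind, whose first term `w 1 - w 0` is Schur-positive by the first inequality.
      have hw := ih m (by omega) (fun j => w (j + 1) - w 0) (hu 0 (by omega))
        (fun j hj => by
          have := hp (j + 1) (by omega)
          rw [show m + 1 + 1 - (j + 1) = m - j + 1 by omega] at this
          simp only [this])
        (fun j hj => by
          have := hu (j + 1) (by omega)
          simpa [SchurLE] using this)
      have := add_mem hbase (X_mul_mem_symmetricUnimodal hw)
      convert this using 1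
      have hsum : ∑ j ∈ Finset.range (m + 1), C (w (j + 1)) * X ^ (j + 1) =
          X * (C (w 0) * bracket (m + 1) +
            ∑ j ∈ Finset.range (m + 1), C (w (j + 1) - w 0) * X ^ j) := by
        rw [bracket, Finset.mul_sum, ← Finset.sum_add_distrib, Finset.mul_sum]
        refine Finset.sum_congr rfl fun j _ => ?_
        rw [C_sub, pow_succ]
        ring
      rw [Finset.sum_range_succ, Finset.sum_range_succ', hsum, hm, bracket_succ (m + 1 + 1),
        bracket_succ' (m + 1),
        pow_zero]
      ring

theorem coeff_of_mem_symmetricUnimodal {m : ℕ} {A : Polynomial Lam}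
    (hA : A ∈ symmetricUnimodal m) :
    (∀ j, m < j → A.coeff j = 0) ∧ (∀ j ≤ m, A.coeff j = A.coeff (m - j)) ∧
      (∀ j, SchurPositive (A.coeff j)) ∧
      (∀ j, 2 * j < m → SchurLE (A.coeff j) (A.coeff (j + 1))) := by
  induction hA using AddSubmonoid.closure_induction with
  | mem A hA =>
    obtain ⟨c, i, k, hc, hm, rfl⟩ := hA
    simp only [coeff_C_mul, coeff_X_pow_mul_bracket, SchurLE]
    refine ⟨fun j hj => ?_, fun j hj => ?_, fun j => ?_, fun j hj => ?_⟩
    · rw [if_neg (by omega), mul_zero]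
    · congr 2
      apply propext
      omega
    · split_ifs
      · rwa [mul_one]
      · rw [mul_zero]
        exact SchurPositive.zero
    · by_cases h1 : i ≤ j
      · rw [if_pos (by omega), if_pos (by omega), sub_self]
        exact SchurPositive.zero
      · rw [if_neg (c := i ≤ j ∧ _) (by omega), mul_zero, sub_zero]
        split_ifs
        · rwa [mul_one]
        · rw [mul_zero]
          exact SchurPositive.zero
  | zero => simp [SchurPositive.zero, SchurLE]
  | add A B _ _ hA hB =>
    obtain ⟨a1, a2, a3, a4⟩ := hA
    obtain ⟨b1, b2, b3, b4⟩ := hB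
    simp only [coeff_add]
    refine ⟨fun j hj => ?_, fun j hj => ?_, fun j => (a3 j).add (b3 j), fun j hj => ?_⟩
    · rw [a1 j hj, b1 j hj, add_zero]
    · rw [a2 j hj, b2 j hj]
    · have := (a4 j hj).add (b4 j hj)
      rwa [SchurLE, add_sub_add_comm]

theorem palindromic_positive_unimodal_of_mem {m : ℕ} {A : Polynomial Lam}
    (hA : A ∈ symmetricUnimodal m) :
    PalindromicOfCenterHalf m A ∧ SchurPositivePoly A ∧ SchurUnimodalPoly m A := by
  obtain ⟨h1, h2, h3, h4⟩ := coeff_of_mem_symmetricUnimodal hA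
  have hdeg : A.natDegree ≤ m := natDegree_le_iff_coeff_eq_zero.2 fun j hj => h1 j hj
  -- The peak is `⌈m/2⌉`, so `j` lies before it exactly when `2 * j < m`; the descent after it is
  -- the mirror image of the ascent.
  refine ⟨⟨hdeg, h2⟩, h3, hdeg, (m + 1) / 2, by omega, fun j hj => h4 j (by omega),
    fun j hj hjm => ?_⟩
  rw [h2 j hjm.le, h2 (j + 1) hjm, show m - j = m - (j + 1) + 1 by omega]
  exact h4 _ (by omega)

/-! ### The recurrences for `Q` and `Qtilde`. -/

/-- The series `1 - ∑_{k ≥ 2} t [k - 1] h_k z^k`. -/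
def denominator : PowerSeries (Polynomial Lam) :=
  1 - PowerSeries.mk fun k => X * bracket (k - 1) * C (h k)

theorem one_sub_t_mul_denominator : (1 - t) * denominator = Ht - t * H := by
  have key : ∀ k : ℕ, (X : Polynomial Lam) ^ (k + 1) - X = (X - 1) * (X * bracket k) := by
    intro k
    have := geom_sum_mul (X : Polynomial Lam) k
    rw [bracket, pow_succ]
    linear_combination (-X) * this
  ext1 n
  rw [sub_mul, one_mul]
  simp only [map_sub, Ht, t, H, denominator, PowerSeries.coeff_rescale, PowerSeries.coeff_C_mul,
    PowerSeries.coeff_mk, PowerSeries.coeff_one]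
  rcases n with _ | n
  · simp [bracket_zero, h_zero]
  · simp only [Nat.add_one_ne_zero, if_false, Nat.add_sub_cancel]
    linear_combination (-C (h (n + 1))) * key n

theorem one_sub_t_ne_zero : (1 - t : PowerSeries (Polynomial Lam)) ≠ 0 := by
  intro h0
  have h1 := congrArg (PowerSeries.coeff 0) h0
  simp only [map_sub, t, PowerSeries.coeff_zero_C, PowerSeries.coeff_zero_one, map_zero] at h1
  have h2 := congrArg (fun p : Polynomial Lam => p.coeff 0) h1
  simp at h2

theorem Q_mul_denominator : PowerSeries.mk Q * denominator = H := by
  refine mul_left_cancel₀ one_sub_t_ne_zero ?_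
  rw [← Q_spec, ← one_sub_t_mul_denominator]
  ring

theorem Q_zero : Q 0 = 1 := by
  have := congrArg (PowerSeries.coeff 0) Q_mul_denominator
  simpa [denominator, H, h_zero, bracket_zero] using this

/-- Since `Q_0 = 1`, starting the inner sum at `m = 1` replaces the series of `Q` by itself minus
`1`. -/
theorem mk_Qtilde : PowerSeries.mk Qtilde = H * (1 - t + t * PowerSeries.mk Q) := by
  have hs : (1 - t + t * PowerSeries.mk Q) =
      1 + t * PowerSeries.mk fun n => if n = 0 then 0 else Q n := by
    have : PowerSeries.mk Q = 1 + PowerSeries.mk fun n => if n = 0 then 0 else Q n := by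
      ext1 n
      rcases n with _ | n <;> simp [PowerSeries.coeff_one, Q_zero]
    rw [this]
    ring
  rw [hs]
  ext1 n
  rw [mul_add, mul_one, mul_left_comm, map_add, PowerSeries.coeff_mk, Qtilde, H,
    PowerSeries.coeff_mk, t, PowerSeries.coeff_C_mul, PowerSeries.coeff_mul]
  congr 2
  rw [← Finset.Nat.sum_antidiagonal_swap, Finset.Nat.sum_antidiagonal_eq_sum_range_succ_mk,
    Finset.sum_range_succ', ← Finset.Ico_add_one_right_eq_Icc,
    ← zero_add 1, ← Finset.sum_Ico_add' (fun m => C (h (n - m)) * Q m) 0 n 1,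
    ← Finset.range_eq_Ico]
  simp

theorem Qtilde_mul_denominator : PowerSeries.mk Qtilde * denominator = H * Ht := by
  rw [mk_Qtilde]
  linear_combination H * t * Q_mul_denominator + H * one_sub_t_mul_denominator

/-- Although the sum contains `P n` itself, the factor `bracket (p.2 - 1)` vanishes for `p.2 ≤ 1`
(truncated subtraction at `0`), so this is a genuine recurrence. -/
theorem coeff_eq_of_mul_denominator {P : ℕ → Polynomial Lam} {B : PowerSeries (Polynomial Lam)}
    (hP : PowerSeries.mk P * denominator = B) (n : ℕ) :
    P n = PowerSeries.coeff n B +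
      ∑ p ∈ Finset.HasAntidiagonal.antidiagonal n, P p.1 * (X * bracket (p.2 - 1) * C (h p.2)) := by
  rw [← hP, denominator, mul_sub, mul_one, map_sub, PowerSeries.coeff_mul]
  simp

/-! ### Membership of `Q` and `Qtilde` in the cone. -/

theorem mul_mem_symmetricUnimodal {m : ℕ} {A : Polynomial Lam}
    (hA : A ∈ symmetricUnimodal m) {k n : ℕ} (hn : m + k = n) :
    A * (X * bracket (k - 1) * C (h k)) ∈ symmetricUnimodal n := by
  rcases k with _ | _ | k
  · simp [bracket_zero, zero_mem]
  · simp [bracket_zero, zero_mem]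
  · have := X_mul_mem_symmetricUnimodal
      (h_mul_mem_symmetricUnimodal (mul_bracket_mem_symmetricUnimodal hA k) (k + 2))
    rw [show m + k + 2 = n by omega] at this
    convert this using 1
    simp only [Nat.add_sub_cancel]
    ring

theorem coeff_H_mul_Ht_mem (n : ℕ) : PowerSeries.coeff n (H * Ht) ∈ symmetricUnimodal n := by
  have := sum_mem_symmetricUnimodal n (fun j => h j * h (n - j))
    ((schurPositive_h n).h_mul 0) (fun j hj => by
      simp only [Nat.sub_sub_self hj]
      exact mul_comm _ _) (fun j hj => by
      have := schurLE_h_mul_h (a := j) (b := n - (j + 1)) (by omega)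
      rwa [show n - (j + 1) + 1 = n - j by omega] at this)
  convert this using 1
  rw [mul_comm, PowerSeries.coeff_mul, Finset.Nat.sum_antidiagonal_eq_sum_range_succ_mk]
  refine Finset.sum_congr rfl fun j _ => ?_
  simp only [Ht, H, PowerSeries.coeff_rescale, PowerSeries.coeff_mk, C_mul]
  ring

theorem Qtilde_mem_symmetricUnimodal (n : ℕ) : Qtilde n ∈ symmetricUnimodal n := by
  induction n using Nat.strong_induction_on with
  | _ n ih =>
    rw [coeff_eq_of_mul_denominator Qtilde_mul_denominator n]
    refine add_mem (coeff_H_mul_Ht_mem n) (sum_mem fun p hp => ?_)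
    rw [Finset.HasAntidiagonal.mem_antidiagonal] at hp
    by_cases h2 : p.2 = 0
    · simp [h2, bracket_zero, zero_mem]
    · exact mul_mem_symmetricUnimodal (ih p.1 (by omega)) hp

theorem Q_mem_symmetricUnimodal (n : ℕ) : Q n ∈ symmetricUnimodal (n - 1) := by
  induction n using Nat.strong_induction_on with
  | _ n ih =>
    rcases n with _ | n
    -- Here `n - 1` truncates to `0`, which is the right center for `Q_0 = 1`.
    · have := mem_symmetricUnimodal (schurPositive_h 0) 0 0 (m := 0) rfl
      simpa [bracket, h_zero, Q_zero] using this
    -- The `Q_0` term is split off because its center does not follow the pattern `(n - 1) / 2`.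
    -- Neither it nor `h_{n+1}` has the required center in general, but together they give `h_{n+1}
    -- (1 + t[n]) = h_{n+1} [n+1]`.
    · rw [coeff_eq_of_mul_denominator Q_mul_denominator, Finset.Nat.sum_antidiagonal_succ,
        ← add_assoc]
      refine add_mem ?_ (sum_mem fun p hp => ?_)
      · have := mem_symmetricUnimodal (schurPositive_h (n + 1)) 0 n (m := n) (by omega)
        rw [Nat.add_sub_cancel]
        convert this using 1
        simp only [H, PowerSeries.coeff_mk, Q_zero, bracket_succ']
        ring
      · rw [Finset.HasAntidiagonal.mem_antidiagonal] at hp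
        by_cases h2 : p.2 = 0
        · simp [h2, bracket_zero, zero_mem]
        · have := ih (p.1 + 1) (by omega)
          exact mul_mem_symmetricUnimodal this (by omega)

end SymFn

theorem corollary3p5 (n : ℕ) :
    (SymFn.PalindromicOfCenterHalf (n - 1) (SymFn.Q n) ∧
      SymFn.SchurPositivePoly (SymFn.Q n) ∧
      SymFn.SchurUnimodalPoly (n - 1) (SymFn.Q n)) ∧
    (SymFn.PalindromicOfCenterHalf n (SymFn.Qtilde n) ∧
      SymFn.SchurPositivePoly (SymFn.Qtilde n) ∧
      SymFn.SchurUnimodalPoly n (SymFn.Qtilde n)) :=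
  ⟨SymFn.palindromic_positive_unimodal_of_mem (SymFn.Q_mem_symmetricUnimodal n),
    SymFn.palindromic_positive_unimodal_of_mem (SymFn.Qtilde_mem_symmetricUnimodal n)⟩
end
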